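/- Setting. Let $p\ge 1$. A unit is $(X,Y(1),Y(0),T)$ with covariates $X\in\mathbb R^p$, real potential outcomes $Y(1),Y(0)$ and binary treatment $T\in\{0,1\}$. The observed data of the unit are $O=(X,T,Y)$ with $Y=TY(1)+(1-T)Y(0)$, and its individual treatment effect is $\Delta=Y(1)-Y(0)$. Let $\mathcal P_{\mathrm{SI}}^{\mathrm{str}}$ be the class of all laws $P$ of $(X,Y(1),Y(0),T)$ such that (a) at least one coordinate of $X$ has a law absolutely continuous with respect to Lebesgue measure on $\mathbb R$, and $Y(1)$ and $Y(0)$ have continuous (atomless) laws; (b) $(Y(1),Y(0))\perp T\mid X$; (c) for some $c_P>0$, the propensity score $e_P(X)=P(T=1\mid X)$ lies in $[c_P,1-c_P]$ almost surely. Conformal meta-learner. Let $m,k\ge 0$. The seed, $m$ training units, $k$ calibration units and one new unit are independent; all units have law $P$, and the seed has a fixed law $\nu$ that does not depend on $P$. From the seed and the observed training data one fits, by arbitrary jointly measurable rules, a pseudo-outcome map $\varphi$ and a real-valued nonconformity score $s(x,y)$ (for instance $|y-\hat\tau(x)|$). The pseudo score of a unit is $V_\varphi=s(X,\varphi(O))$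 and its oracle score is $V^*=s(X,\Delta)$. For $\alpha\in(0,1)$ let $\widehat Q$ be the $\lceil(1-\alpha)(k+1)\rceil$-th smallest pseudo score of the $k$ calibration units, with $\widehat Q=+\infty$ if $\lceil(1-\alpha)(k+1)\rceil>k$. The conformal pseudo-interval is $\widehat C_\varphi(x)=\{y\in\mathbb R: s(x,y)\le\widehat Q\}$. Statement. Suppose that for every $P\in\mathcal P_{\mathrm{SI}}^{\mathrm{str}}$ the pseudo score first-order stochastically dominates the oracle score: for almost every seed and training sample, with the fitted functions held fixed, the scores of a new unit satisfy $$P(V_\varphi\le v)\le P(V^*\le v)\qquad\text{for all }v\in\mathbb R .$$ (Strict inequality for some $v$ is not required.) Then, with $X$ the covariates of the new unit and the probability taken over the seed and all units, $$\mathbb P_P\bigl(y\notin\widehat C_\varphi(X)\bigr)\le\alpha\qquad\text{for all }P\in\mathcal P_{\mathrm{SI}}^{\mathrm{str}}\text{ and all }y\in\mathbb R .$$ Consequently, with $\mathrm{length}$ denoting Lebesgue measure, $$\sup_{P\in\mathcal P_{\mathrm{SI}}^{\mathrm{str}}}\mathbb E_P\bigl[\mathrm{length}(\widehat C_\varphi(X))\bigr]=\infty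 .$$ -/

import Mathlib

open MeasureTheory ProbabilityTheory
open scoped ENNReal

namespace ITE

/-- The covariate space `ℝ^p`. -/
abbrev Cov (p : ℕ) : Type := Fin p → ℝ

/-- Full data `(X, (Y(1), Y(0)), T)` of one unit; the treatment is binary. -/
abbrev FullData (p : ℕ) : Type := Cov p × (ℝ × ℝ) × Bool

/-- Observed data `(X, T, Y)` of one unit. -/
abbrev ObsData (p : ℕ) : Type := Cov p × Bool × ℝ

variable {p : ℕ}

/-- The covariate vector `X`. -/
def covariate (ω : FullData p) : Cov p := ω.1

/-- The pair of potential outcomes `(Y(1), Y(0))`. -/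
def outcomes (ω : FullData p) : ℝ × ℝ := ω.2.1

/-- The treatment indicator `T`. -/
def treatment (ω : FullData p) : Bool := ω.2.2

/-- The individual treatment effect `Δ = Y(1) - Y(0)`. -/
def effect (ω : FullData p) : ℝ := (outcomes ω).1 - (outcomes ω).2

/-- The observed part `(X, T, Y)` with `Y = T Y(1) + (1 - T) Y(0)`. -/
def observe (ω : FullData p) : ObsData p :=
  (covariate ω, treatment ω, if treatment ω then (outcomes ω).1 else (outcomes ω).2)

lemma measurable_covariate : Measurable (covariate : FullData p → Cov p) := measurable_fst

/-- The sigma-field generated by the covariates. -/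
abbrev covariateSigma (p : ℕ) : MeasurableSpace (FullData p) :=
  MeasurableSpace.comap covariate inferInstance

lemma covariateSigma_le (p : ℕ) : covariateSigma p ≤ Prod.instMeasurableSpace :=
  measurable_covariate.comap_le

/-- The class of all laws of `(X, Y(1), Y(0), T)` for which some coordinate of `X` is absolutely
continuous with respect to Lebesgue measure and `Y(1)`, `Y(0)` have continuous (atomless) laws. -/
def baseClass (p : ℕ) : Set (ProbabilityMeasure (FullData p)) :=
  {P | (∃ j : Fin p, (P : Measure (FullData p)).map (fun ω => covariate ω j) ≪ volume) ∧
    (∀ y : ℝ, (P : Measure (FullData p)) {ω | (outcomes ω).1 = y} = 0) ∧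
    (∀ y : ℝ, (P : Measure (FullData p)) {ω | (outcomes ω).2 = y} = 0)}

/-- The strong-ignorability class: `(Y(1), Y(0))` is independent of `T` given `X`. -/
def siClass (p : ℕ) : Set (ProbabilityMeasure (FullData p)) :=
  {P | P ∈ baseClass p ∧
    CondIndepFun (covariateSigma p) (covariateSigma_le p) outcomes treatment
      (P : Measure (FullData p))}

/-- The propensity score `e_P(X) = P(T = 1 | X)`. -/
noncomputable def propensity (P : ProbabilityMeasure (FullData p)) : FullData p → ℝ :=
  (P : Measure (FullData p))⟦treatment ⁻¹' {true}|covariateSigma p⟧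

/-- The strong-overlap class: strong ignorability holds and `e_P(X) ∈ [c, 1 - c]` almost surely,
for some `c > 0` that may depend on `P`. -/
def siStrClass (p : ℕ) : Set (ProbabilityMeasure (FullData p)) :=
  {P | P ∈ siClass p ∧ ∃ c : ℝ, 0 < c ∧
    ∀ᵐ ω ∂(P : Measure (FullData p)), propensity P ω ∈ Set.Icc c (1 - c)}

/-- First-order stochastic dominance of laws on `ℝ`, in its weak form: the cdf of the dominating
law `μ` lies below that of `ν` everywhere. Strict inequality at some point is not required. -/
def FirstOrderDominates (μ ν : Measure ℝ) : Prop := ∀ v : ℝ, cdf μ v ≤ cdf ν v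

/-- A conformal meta-learner with a training sample of size `m` and a random seed in `U`.
The nuisance functions and the effect estimator are fitted on the training sample, with the help
of the seed. After this, `pseudo` turns the observed data of one unit into its pseudo-outcome, and
`score` is the nonconformity score as a function of a covariate value and a (true or pseudo)
treatment effect, for instance `|y - τ̂(x)|`. -/
structure MetaLearner (p m : ℕ) (U : Type*) [MeasurableSpace U] where
  pseudo : U → (Fin m → ObsData p) → ObsData p → ℝ
  score : U → (Fin m → ObsData p) → Cov p → ℝ → ℝ
  measurable_pseudo :
    Measurable fun z : U × (Fin m → ObsData p) × ObsData p => pseudo z.1 z.2.1 z.2.2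
  measurable_score :
    Measurable fun z : U × (Fin m → ObsData p) × Cov p × ℝ => score z.1 z.2.1 z.2.2.1 z.2.2.2

/-- The split-conformal quantile of `k` calibration scores: the `⌈(1 - α)(k + 1)⌉`-th smallest of
them, and `+∞` if that number exceeds `k`. Equivalently, the empirical quantile of order
`(1 - α)(1 + 1/k)`. -/
noncomputable def conformalQuantile {k : ℕ} (α : ℝ) (v : Fin k → ℝ) : EReal :=
  sInf {q : EReal |
    (1 - α) * ((k : ℝ) + 1) ≤ ((Finset.univ.filter fun i => (v i : EReal) ≤ q).card : ℝ)}

namespace MetaLearner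

variable {m : ℕ} {U : Type*} [MeasurableSpace U] (L : MetaLearner p m U)

/-- The oracle score `V^*` of a unit: the score at its treatment effect. -/
def oracleScore (u : U) (d : Fin m → ObsData p) (ω : FullData p) : ℝ :=
  L.score u d (covariate ω) (effect ω)

/-- The pseudo score `V_φ` of an observed unit: the score at its pseudo-outcome. -/
def pseudoScore (u : U) (d : Fin m → ObsData p) (o : ObsData p) : ℝ :=
  L.score u d o.1 (L.pseudo u d o)

/-- The conformal pseudo-interval at level `1 - α`, computed from the seed, the observed training
sample `d` and the observed calibration sample `c`. -/
def pseudoInterval {k : ℕ} (α : ℝ) (u : U) (d : Fin m → ObsData p) (c : Fin k → ObsData p)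
    (x : Cov p) : Set ℝ :=
  {y | (L.score u d x y : EReal) ≤ conformalQuantile α fun i => L.pseudoScore u d (c i)}

/-- Under `P`, the pseudo score dominates the oracle score in first order. Both scores are those
of a new unit, with the fitted functions held fixed; the dominance is required for almost every
seed and training sample. -/
def PseudoDominatesOracle (ν : Measure U) (P : ProbabilityMeasure (FullData p)) : Prop :=
  ∀ᵐ z : U × (Fin m → FullData p)
      ∂(ν.prod (Measure.pi fun _ : Fin m => (P : Measure (FullData p)))),
    FirstOrderDominates
      ((P : Measure (FullData p)).map fun ω =>
        L.pseudoScore z.1 (fun i => observe (z.2 i)) (observe ω))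
      ((P : Measure (FullData p)).map fun ω =>
        L.oracleScore z.1 (fun i => observe (z.2 i)) ω)

end MetaLearner

/-- Seed, training units, calibration units and a new unit. -/
abbrev Experiment (p m k : ℕ) (U : Type*) : Type _ :=
  U × (Fin m → FullData p) × (Fin k → FullData p) × FullData p

/-- The law of the experiment: the seed has law `ν`, and all `m + k + 1` units are i.i.d. with law
`P` and independent of the seed. -/
noncomputable def experimentLaw (m k : ℕ) {U : Type*} [MeasurableSpace U] (ν : Measure U)
    (P : ProbabilityMeasure (FullData p)) : Measure (Experiment p m k U) :=
  ν.prod ((Measure.pi fun _ : Fin m => (P : Measure (FullData p))).prod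
    ((Measure.pi fun _ : Fin k => (P : Measure (FullData p))).prod (P : Measure (FullData p))))

/-- The random set `Ĉ_φ(X)`: the pseudo-interval at the covariates of the new unit. -/
def MetaLearner.intervalAtNew {m k : ℕ} {U : Type*} [MeasurableSpace U] (L : MetaLearner p m U)
    (α : ℝ) (e : Experiment p m k U) : Set ℝ :=
  L.pseudoInterval α e.1 (fun i => observe (e.2.1 i)) (fun i => observe (e.2.2.1 i))
    (covariate e.2.2.2)

end ITE

/-! Fix a law `P` and a value `y`. Since the covariates have an atomless law, the covariate space
can be cut into finitely many cells so fine that all `m + k + 1` units fall into distinct cells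
with probability close to one. On that event the observed sample is a mixture of i.i.d. samples
from laws under which the treatment is a function `t` of the cell: draw the label `t i` of each
cell `i` in advance from the conditional law of the treatment. Up to a factor `1 - ε`, such a law
is dominated by the observed law of a twin unit with constant treatment effect `y`, whose treatment
is `t` of the cell flipped with a tiny probability `ε`: it is ignorable because it is drawn from
the covariates alone, and the flip secures overlap. For the twin law the assumed dominance and
exchangeability make the conformal interval miss the effect `y` with probability at most `α`.
Letting `ε → 0` and refining the cells transfers the bound to `P`. Since every `y` is then covered
with probability at least `1 - α > 0`, Tonelli's theorem makes the expected length infinite. -/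

namespace ITE

open Filter Topology
open scoped NNReal

section ProductMeasures

variable {ι : Type*} [Fintype ι]

section Heterogeneous

variable {Ω : ι → Type*} [∀ i, MeasurableSpace (Ω i)]

lemma pi_mono {μ ν : ∀ i, Measure (Ω i)} (h : ∀ i, μ i ≤ ν i) :
    Measure.pi μ ≤ Measure.pi ν := by
  refine Measure.le_iff.2 fun s hs => ?_
  rw [Measure.pi, Measure.pi, toMeasure_apply _ _ hs, toMeasure_apply _ _ hs]
  exact OuterMeasure.le_pi.2 (fun t _ => (OuterMeasure.pi_pi_le _ t).trans
    (Finset.prod_le_prod' fun i _ => h i (t i))) s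

lemma lintegral_prod_pi (μ : ∀ i, Measure (Ω i)) [∀ i, IsProbabilityMeasure (μ i)]
    {f : ∀ i, Ω i → ℝ≥0∞} (hf : ∀ i, Measurable (f i)) :
    ∫⁻ w, ∏ i, f i (w i) ∂Measure.pi μ = ∏ i, ∫⁻ x, f i x ∂μ i := by
  rw [lintegral_prod_eq_prod_lintegral_of_indepFun Finset.univ
    (fun i (w : ∀ i, Ω i) => f i (w i))
    (iIndepFun_pi fun i => (hf i).aemeasurable) fun i => (hf i).comp (measurable_pi_apply i)]
  exact Finset.prod_congr rfl fun i _ => (measurePreserving_eval μ i).lintegral_comp (hf i)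

lemma pi_withDensity (μ : ∀ i, Measure (Ω i)) [∀ i, IsProbabilityMeasure (μ i)]
    {r : ∀ i, Ω i → ℝ≥0∞} (hr : ∀ i, Measurable (r i))
    [∀ i, SigmaFinite ((μ i).withDensity (r i))] :
    Measure.pi (fun i => (μ i).withDensity (r i)) =
      (Measure.pi μ).withDensity fun w => ∏ i, r i (w i) := by
  refine Measure.pi_eq fun s hs => ?_
  rw [withDensity_apply _ (.univ_pi hs), ← lintegral_indicator (.univ_pi hs)]
  simp_rw [withDensity_apply _ (hs _), ← lintegral_indicator (hs _)]
  rw [← lintegral_prod_pi μ fun i => (hr i).indicator (hs i)]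
  refine lintegral_congr fun w => ?_
  by_cases hw : w ∈ Set.univ.pi s
  · rw [Set.indicator_of_mem hw]
    exact Finset.prod_congr rfl fun i _ => (Set.indicator_of_mem (hw i trivial) _).symm
  · obtain ⟨i, hi⟩ : ∃ i, w i ∉ s i := by simpa using hw
    rw [Set.indicator_of_notMem hw,
      Finset.prod_eq_zero (Finset.mem_univ i) (Set.indicator_of_notMem hi _)]

end Heterogeneous

variable {Ω : Type*} [MeasurableSpace Ω]

lemma pow_smul_pi_le_pi {ρ μ : Measure Ω} [SigmaFinite ρ] {a : ℝ≥0} (h : a • ρ ≤ μ) :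
    a ^ Fintype.card ι • (Measure.pi fun _ : ι => ρ) ≤ Measure.pi fun _ : ι => μ := by
  have hpi : (Measure.pi fun _ : ι => a • ρ) =
      a ^ Fintype.card ι • (Measure.pi fun _ : ι => ρ) :=
    Measure.pi_eq fun s _ => by
      simp only [Measure.smul_apply, Measure.pi_pi, ENNReal.smul_def, smul_eq_mul,
        ENNReal.coe_pow, Finset.prod_mul_distrib, Finset.prod_const, Finset.card_univ]
  rw [← hpi]
  exact pi_mono fun _ => h

lemma measurePreserving_comp_perm_pi (μ : Measure Ω) [SigmaFinite μ] (σ : Equiv.Perm ι) :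
    MeasurePreserving (fun w : ι → Ω => w ∘ σ) (Measure.pi fun _ => μ) (Measure.pi fun _ => μ) :=
  measurePreserving_arrowCongr' (fun _ => μ) (fun _ => μ) σ.symm (.refl Ω) fun _ => .id μ

variable {ι' : Type*} [Fintype ι']

lemma measurePreserving_sumElim_pi (μ : Measure Ω) [SigmaFinite μ] :
    MeasurePreserving (fun z : (ι → Ω) × (ι' → Ω) => (Sum.elim z.1 z.2 : ι ⊕ ι' → Ω))
      ((Measure.pi fun _ => μ).prod (Measure.pi fun _ => μ)) (Measure.pi fun _ => μ) := by
  convert! measurePreserving_sumPiEquivProdPi_symm (fun _ : ι ⊕ ι' => μ) using 1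

lemma measurePreserving_sumElim_const_pi (μ : Measure Ω) [SigmaFinite μ] :
    MeasurePreserving (fun z : (ι → Ω) × Ω => (Sum.elim z.1 fun _ => z.2 : ι ⊕ Unit → Ω))
      ((Measure.pi fun _ => μ).prod μ) (Measure.pi fun _ => μ) :=
  (measurePreserving_sumElim_pi μ).comp
    ((MeasurePreserving.id _).prod (measurePreserving_funUnique μ Unit).symm)

end ProductMeasures

section Rank

variable {ι R : Type*} [Fintype ι] [LinearOrder R]

/-- The rank of the `j`-th member of a finite family, counted from `0`: the number of members
strictly below it, so that tied members share the lowest of their ranks. -/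
def strictRank (v : ι → R) (j : ι) : ℕ := (Finset.univ.filter fun i => v i < v j).card

lemma strictRank_comp_perm (v : ι → R) (σ : Equiv.Perm ι) (j : ι) :
    strictRank (v ∘ σ) j = strictRank v (σ j) :=
  Finset.card_equiv σ (by simp)

lemma strictRank_sumElim_inr {κ : Type*} [Fintype κ] (v : κ → R) (s : R) :
    strictRank (Sum.elim v fun _ : Unit => s) (.inr ()) =
      (Finset.univ.filter fun i => v i < s).card := by
  rw [strictRank, Finset.card_filter, Finset.card_filter, Fintype.sum_sum_type]
  simp only [Sum.elim_inl, Sum.elim_inr, lt_irrefl, if_false, Finset.sum_const_zero, add_zero]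
  rfl

lemma card_le_strictRank_le (v : ι → R) {α : ℝ} (hα : 0 ≤ α) :
    ((Finset.univ.filter fun j => (1 - α) * Fintype.card ι ≤ strictRank v j).card : ℝ) ≤
      α * Fintype.card ι := by
  classical
  set J := Finset.univ.filter fun j => (1 - α) * Fintype.card ι ≤ strictRank v j
  rcases J.eq_empty_or_nonempty with hJ | hJ
  · rw [hJ, Finset.card_empty, Nat.cast_zero]
    positivity
  · obtain ⟨j, hj, hmin⟩ := J.exists_min_image v hJ
    have hdisj : Disjoint J (Finset.univ.filter fun i => v i < v j) :=
      Finset.disjoint_left.2 fun i hi hij => (Finset.mem_filter.1 hij).2.not_ge (hmin i hi)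
    have hcard : (J.card : ℝ) + strictRank v j ≤ Fintype.card ι := by
      exact_mod_cast (Finset.card_union_of_disjoint hdisj).ge.trans (Finset.card_le_univ _)
    linarith [(Finset.mem_filter.1 hj).2]

variable [TopologicalSpace R] [OrderClosedTopology R] [SecondCountableTopology R]
  [MeasurableSpace R] [OpensMeasurableSpace R]

lemma measurable_strictRank (j : ι) : Measurable fun v : ι → R => strictRank v j := by
  simp_rw [strictRank, Finset.card_filter]
  exact Finset.measurable_sum _ fun i _ => Measurable.ite
    (measurableSet_lt (measurable_pi_apply i) (measurable_pi_apply j))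
    measurable_const measurable_const

lemma measurableSet_le_strictRank (a : ℝ) (j : ι) :
    MeasurableSet {v : ι → R | a ≤ strictRank v j} :=
  measurableSet_le measurable_const (measurable_from_nat.comp (measurable_strictRank j))

lemma measure_le_strictRank_le_of_exchangeable {π : Measure (ι → R)} [IsProbabilityMeasure π]
    (hπ : ∀ σ : Equiv.Perm ι, MeasurePreserving (fun v => v ∘ σ) π π) {α : ℝ} (hα : 0 ≤ α)
    (j : ι) : π {v | (1 - α) * Fintype.card ι ≤ strictRank v j} ≤ ENNReal.ofReal α := by
  classical
  set E : ι → Set (ι → R) := fun j => {v | (1 - α) * Fintype.card ι ≤ strictRank v j}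
  have hE : ∀ i, MeasurableSet (E i) := measurableSet_le_strictRank _
  have hEq : ∀ i, π (E i) = π (E j) := fun i => by
    rw [← (hπ (Equiv.swap j i)).measure_preimage (hE j).nullMeasurableSet]
    simp only [E, Set.preimage_ofPred_eq, strictRank_comp_perm, Equiv.swap_apply_left]
  have hsum : Fintype.card ι * π (E j) ≤ Fintype.card ι * ENNReal.ofReal α := calc
    Fintype.card ι * π (E j) = ∑ i, π (E i) := by simp [hEq]
    _ = ∫⁻ v, ∑ i, (E i).indicator 1 v ∂π := by
      rw [lintegral_finsetSum _ fun i _ => measurable_one.indicator (hE i)]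
      simp_rw [lintegral_indicator_one (hE _)]
    _ ≤ ∫⁻ _, ENNReal.ofReal (α * Fintype.card ι) ∂π := by
      refine lintegral_mono fun v => ?_
      have hcount : ∑ i, (E i).indicator (1 : (ι → R) → ℝ≥0∞) v =
          (Finset.univ.filter fun i => v ∈ E i).card := by simp [Set.indicator_apply]
      rw [hcount, ← ENNReal.ofReal_natCast]
      exact ENNReal.ofReal_le_ofReal (card_le_strictRank_le v hα)
    _ = Fintype.card ι * ENNReal.ofReal α := by simp [ENNReal.ofReal_mul hα, mul_comm]
  have : Nonempty ι := ⟨j⟩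
  exact (ENNReal.mul_le_mul_iff_right (by simp) (by simp)).1 hsum

end Rank

section ConformalQuantile

variable {k : ℕ} {α : ℝ}

lemma conformalQuantile_lt_coe_iff (hα : α < 1) (v : Fin k → ℝ) (s : ℝ) :
    conformalQuantile α v < s ↔ (1 - α) * Fintype.card (Fin k ⊕ Unit) ≤
      strictRank (Sum.elim v fun _ : Unit => s) (.inr ()) := by
  have hcard : (Fintype.card (Fin k ⊕ Unit) : ℝ) = k + 1 := by simp
  rw [strictRank_sumElim_inr, hcard, conformalQuantile, sInf_lt_iff]
  refine ⟨fun ⟨q, hq, hqs⟩ => hq.trans ?_, fun h => ?_⟩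
  · exact_mod_cast Finset.card_le_card (Finset.monotone_filter_right _ fun i _ hi =>
      EReal.coe_lt_coe_iff.1 (lt_of_le_of_lt hi hqs))
  · have hpos : (0 : ℝ) < (1 - α) * (k + 1) := mul_pos (sub_pos.2 hα) (by positivity)
    have hne : (Finset.univ.filter fun i => v i < s).Nonempty :=
      Finset.card_pos.1 (by exact_mod_cast hpos.trans_le h)
    obtain ⟨j, hj, hmax⟩ := Finset.exists_max_image _ v hne
    refine ⟨v j, h.trans ?_, EReal.coe_lt_coe_iff.2 (Finset.mem_filter.1 hj).2⟩
    exact_mod_cast Finset.card_le_card (Finset.monotone_filter_right _ fun i hi his =>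
      EReal.coe_le_coe_iff.2 (hmax i (Finset.mem_filter.2 ⟨hi, his⟩)))

lemma measurableSet_conformalQuantile_lt (hα : α < 1) :
    MeasurableSet {z : (Fin k → ℝ) × ℝ | conformalQuantile α z.1 < z.2} := by
  simp_rw [conformalQuantile_lt_coe_iff hα]
  exact (measurePreserving_sumElim_const_pi volume).measurable (measurableSet_le_strictRank _ _)

lemma prod_conformalQuantile_lt_le (hα₀ : 0 ≤ α) (hα₁ : α < 1) (ρ : Measure ℝ)
    [IsProbabilityMeasure ρ] :
    ((Measure.pi fun _ : Fin k => ρ).prod ρ) {z | conformalQuantile α z.1 < z.2} ≤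
      ENNReal.ofReal α := by
  have h := measure_le_strictRank_le_of_exchangeable
    (measurePreserving_comp_perm_pi (ι := Fin k ⊕ Unit) ρ) hα₀ (.inr ())
  rw [← (measurePreserving_sumElim_const_pi ρ).measure_preimage
    (measurableSet_le_strictRank _ _).nullMeasurableSet] at h
  simp_rw [conformalQuantile_lt_coe_iff hα₁]
  exact h

variable {ρ ρ' : Measure ℝ} [IsProbabilityMeasure ρ] [IsProbabilityMeasure ρ']

lemma FirstOrderDominates.measure_lt_coe_le (h : FirstOrderDominates ρ ρ') (q : EReal) :
    ρ' {s : ℝ | q < s} ≤ ρ {s : ℝ | q < s} := by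
  induction q with
  | bot => simp
  | top => simp
  | coe q =>
    have hq := h q
    rw [cdf_eq_real, cdf_eq_real] at hq
    have hIoi : {s : ℝ | (q : EReal) < s} = (Set.Iic q)ᶜ := by ext; simp
    rw [hIoi, prob_compl_eq_one_sub measurableSet_Iic, prob_compl_eq_one_sub measurableSet_Iic]
    exact tsub_le_tsub_left
      ((ENNReal.toReal_le_toReal (measure_ne_top _ _) (measure_ne_top _ _)).1 hq) 1

lemma FirstOrderDominates.prod_conformalQuantile_lt_le (h : FirstOrderDominates ρ ρ')
    (hα₀ : 0 ≤ α) (hα₁ : α < 1) :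
    ((Measure.pi fun _ : Fin k => ρ).prod ρ') {z | conformalQuantile α z.1 < z.2} ≤
      ENNReal.ofReal α := by
  refine le_trans ?_ (ITE.prod_conformalQuantile_lt_le (k := k) hα₀ hα₁ ρ)
  rw [Measure.prod_apply (measurableSet_conformalQuantile_lt hα₁),
    Measure.prod_apply (measurableSet_conformalQuantile_lt hα₁)]
  exact lintegral_mono fun v => h.measure_lt_coe_le (conformalQuantile α v)

end ConformalQuantile

variable {p m k : ℕ} {U : Type*} [MeasurableSpace U] {α : ℝ}

section ObservedSample

lemma measurable_outcomes : Measurable (outcomes : FullData p → ℝ × ℝ) :=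
  measurable_fst.comp measurable_snd

lemma measurable_treatment : Measurable (treatment : FullData p → Bool) :=
  measurable_snd.comp measurable_snd

lemma measurable_effect : Measurable (effect : FullData p → ℝ) :=
  (measurable_fst.comp measurable_outcomes).sub (measurable_snd.comp measurable_outcomes)

lemma measurable_observe : Measurable (observe : FullData p → ObsData p) :=
  measurable_covariate.prodMk <| measurable_treatment.prodMk <|
    Measurable.ite (measurable_treatment (measurableSet_singleton true))
      (measurable_fst.comp measurable_outcomes) (measurable_snd.comp measurable_outcomes)

/-- The law of the observed data of a unit with law `P`. -/
noncomputable def observedLaw (P : ProbabilityMeasure (FullData p)) : Measure (ObsData p) :=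
  (P : Measure (FullData p)).map observe

instance (P : ProbabilityMeasure (FullData p)) : IsProbabilityMeasure (observedLaw P) :=
  Measure.isProbabilityMeasure_map measurable_observe.aemeasurable

lemma measurePreserving_observe (P : ProbabilityMeasure (FullData p)) :
    MeasurePreserving observe (P : Measure (FullData p)) (observedLaw P) :=
  ⟨measurable_observe, rfl⟩

/-- The units of an experiment: training units, calibration units and the new unit. -/
abbrev SampleIndex (m k : ℕ) : Type := Fin m ⊕ Fin k ⊕ Unit

/-- The observed data of all units of an experiment, as one family. -/
def observedSample (e : Experiment p m k U) : SampleIndex m k → ObsData p :=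
  observe ∘ Sum.elim e.2.1 (Sum.elim e.2.2.1 fun _ => e.2.2.2)

lemma measurePreserving_observedSample (ν : Measure U) [SFinite ν]
    (P : ProbabilityMeasure (FullData p)) :
    MeasurePreserving (fun e : Experiment p m k U => (e.1, observedSample e))
      (experimentLaw m k ν P) (ν.prod (Measure.pi fun _ => observedLaw P)) :=
  (MeasurePreserving.id ν).prod <|
    (measurePreserving_pi (fun _ : SampleIndex m k => (P : Measure (FullData p))) _ fun _ =>
      measurePreserving_observe P).comp <|
    (measurePreserving_sumElim_pi _).comp <|
    (MeasurePreserving.id _).prod (measurePreserving_sumElim_const_pi _)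

end ObservedSample

instance (ν : Measure U) [IsProbabilityMeasure ν] (P : ProbabilityMeasure (FullData p)) :
    IsProbabilityMeasure (experimentLaw m k ν P) := by
  unfold experimentLaw
  infer_instance

namespace MetaLearner

variable (L : MetaLearner p m U)

/-- The pseudo-interval as a function of the seed and the observed sample. -/
def sampleInterval (α : ℝ) (u : U) (o : SampleIndex m k → ObsData p) : Set ℝ :=
  L.pseudoInterval α u (o ∘ .inl) (o ∘ .inr ∘ .inl) (o (.inr (.inr ()))).1

lemma notMem_pseudoInterval_iff {u : U} {d : Fin m → ObsData p} {c : Fin k → ObsData p}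
    {x : Cov p} {y : ℝ} : y ∉ L.pseudoInterval α u d c x ↔
      conformalQuantile α (fun i => L.pseudoScore u d (c i)) < L.score u d x y := by
  rw [pseudoInterval, Set.mem_ofPred_eq, not_le]

section Measurability

variable {S : Type*} [MeasurableSpace S] {u : S → U} {d : S → Fin m → ObsData p}

lemma measurable_score_comp (hu : Measurable u) (hd : Measurable d) {x : S → Cov p} {y : S → ℝ}
    (hx : Measurable x) (hy : Measurable y) :
    Measurable fun z => L.score (u z) (d z) (x z) (y z) :=
  L.measurable_score.comp (hu.prodMk (hd.prodMk (hx.prodMk hy)))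

lemma measurable_pseudoScore_comp (hu : Measurable u) (hd : Measurable d) {o : S → ObsData p}
    (ho : Measurable o) : Measurable fun z => L.pseudoScore (u z) (d z) (o z) :=
  L.measurable_score_comp hu hd (measurable_fst.comp ho)
    (L.measurable_pseudo.comp (hu.prodMk (hd.prodMk ho)))

end Measurability

lemma measurableSet_notMem_sampleInterval (hα : α < 1) :
    MeasurableSet {z : (U × (SampleIndex m k → ObsData p)) × ℝ |
      z.2 ∉ L.sampleInterval α z.1.1 z.1.2} := by
  simp_rw [sampleInterval, notMem_pseudoInterval_iff]
  have hd : Measurable fun z : (U × (SampleIndex m k → ObsData p)) × ℝ =>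
      z.1.2 ∘ Sum.inl := by fun_prop
  have hcalib : Measurable fun (z : (U × (SampleIndex m k → ObsData p)) × ℝ) (i : Fin k) =>
      L.pseudoScore z.1.1 (z.1.2 ∘ .inl) (z.1.2 (.inr (.inl i))) :=
    measurable_pi_lambda _ fun i => L.measurable_pseudoScore_comp (by fun_prop) hd (by fun_prop)
  have hnew : Measurable fun z : (U × (SampleIndex m k → ObsData p)) × ℝ =>
      L.score z.1.1 (z.1.2 ∘ .inl) (z.1.2 (.inr (.inr ()))).1 z.2 :=
    L.measurable_score_comp (by fun_prop) hd (by fun_prop) measurable_snd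
  exact (hcalib.prodMk hnew) (measurableSet_conformalQuantile_lt hα)

lemma measurableSet_notMem_intervalAtNew (hα : α < 1) :
    MeasurableSet {z : Experiment p m k U × ℝ | z.2 ∉ L.intervalAtNew α z.1} :=
  ((measurePreserving_observedSample (0 : Measure U) default).measurable.prodMap measurable_id)
    (L.measurableSet_notMem_sampleInterval hα)

variable {ν : Measure U} [IsProbabilityMeasure ν] {P : ProbabilityMeasure (FullData p)}

lemma prod_effect_notMem_pseudoInterval_le {u : U} {d : Fin m → ObsData p}
    (hdom : FirstOrderDominates
      ((P : Measure (FullData p)).map fun ω => L.pseudoScore u d (observe ω))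
      ((P : Measure (FullData p)).map fun ω => L.oracleScore u d ω))
    (hα₀ : 0 ≤ α) (hα₁ : α < 1) :
    ((Measure.pi fun _ : Fin k => (P : Measure (FullData p))).prod (P : Measure (FullData p)))
      {w | effect w.2 ∉ L.pseudoInterval α u d (fun i => observe (w.1 i)) (covariate w.2)} ≤
      ENNReal.ofReal α := by
  have hV : Measurable fun ω => L.pseudoScore u d (observe ω) :=
    L.measurable_pseudoScore_comp measurable_const measurable_const measurable_observe
  have hO : Measurable fun ω => L.oracleScore u d ω :=
    L.measurable_score_comp measurable_const measurable_const measurable_covariate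
      measurable_effect
  have := Measure.isProbabilityMeasure_map (μ := (P : Measure (FullData p))) hV.aemeasurable
  have := Measure.isProbabilityMeasure_map (μ := (P : Measure (FullData p))) hO.aemeasurable
  have hscores := (measurePreserving_pi (fun _ : Fin k => (P : Measure (FullData p))) _ fun _ =>
    hV.measurePreserving _).prod (hO.measurePreserving P)
  refine le_of_eq_of_le ?_ (hdom.prod_conformalQuantile_lt_le (k := k) hα₀ hα₁)
  rw [← hscores.measure_preimage (measurableSet_conformalQuantile_lt hα₁).nullMeasurableSet]
  exact congrArg _ (Set.ext fun w => L.notMem_pseudoInterval_iff)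

variable {L} in
lemma PseudoDominatesOracle.experimentLaw_effect_notMem_le
    (hdom : L.PseudoDominatesOracle ν P) (hα₀ : 0 ≤ α) (hα₁ : α < 1) :
    experimentLaw m k ν P {e | effect e.2.2.2 ∉ L.intervalAtNew α e} ≤ ENNReal.ofReal α := by
  have hassoc := measurePreserving_prodAssoc ν
    (Measure.pi fun _ : Fin m => (P : Measure (FullData p)))
    ((Measure.pi fun _ : Fin k => (P : Measure (FullData p))).prod (P : Measure (FullData p)))
  have hmeas : MeasurableSet {e : Experiment p m k U | effect e.2.2.2 ∉ L.intervalAtNew α e} :=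
    (measurable_id.prodMk (measurable_effect.comp (by fun_prop)))
      (L.measurableSet_notMem_intervalAtNew hα₁)
  rw [experimentLaw, ← hassoc.measure_preimage hmeas.nullMeasurableSet,
    Measure.prod_apply (hassoc.measurable hmeas)]
  calc _ ≤ ∫⁻ _, ENNReal.ofReal α
        ∂(ν.prod (Measure.pi fun _ : Fin m => (P : Measure (FullData p)))) :=
        lintegral_mono_ae (hdom.mono fun z hz =>
          L.prod_effect_notMem_pseudoInterval_le hz hα₀ hα₁)
    _ = ENNReal.ofReal α := by simp

variable {L} in
lemma PseudoDominatesOracle.experimentLaw_notMem_le_of_effect_eq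
    (hdom : L.PseudoDominatesOracle ν P) (hα₀ : 0 ≤ α) (hα₁ : α < 1) {y : ℝ}
    (hy : ∀ᵐ ω ∂(P : Measure (FullData p)), effect ω = y) :
    experimentLaw m k ν P {e | y ∉ L.intervalAtNew α e} ≤ ENNReal.ofReal α := by
  have hnew : MeasurePreserving (fun e : Experiment p m k U => e.2.2.2)
      (experimentLaw m k ν P) P :=
    measurePreserving_snd.comp (measurePreserving_snd.comp measurePreserving_snd)
  refine le_of_eq_of_le (measure_congr ?_)
    (hdom.experimentLaw_effect_notMem_le hα₀ hα₁)
  filter_upwards [hnew.quasiMeasurePreserving.ae hy] with e he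
  exact congrArg (fun t => t ∉ L.intervalAtNew α e) he.symm

/-- The probability over the seed that the pseudo-interval misses `y`, as a function of the
observed sample. -/
noncomputable def missProb (ν : Measure U) (α y : ℝ) (o : SampleIndex m k → ObsData p) : ℝ≥0∞ :=
  ν {u | y ∉ L.sampleInterval α u o}

lemma measurableSet_notMem_sampleInterval_const (hα : α < 1) (y : ℝ) :
    MeasurableSet {z : U × (SampleIndex m k → ObsData p) | y ∉ L.sampleInterval α z.1 z.2} :=
  measurable_prodMk_right (L.measurableSet_notMem_sampleInterval hα)

lemma measurable_missProb (hα : α < 1) (y : ℝ) :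
    Measurable (L.missProb ν α y : (SampleIndex m k → ObsData p) → ℝ≥0∞) :=
  measurable_measure_prodMk_right (L.measurableSet_notMem_sampleInterval_const hα y)

lemma experimentLaw_notMem_eq_lintegral_missProb (hα : α < 1) (y : ℝ) :
    experimentLaw m k ν P {e | y ∉ L.intervalAtNew α e} =
      ∫⁻ o : SampleIndex m k → ObsData p, L.missProb ν α y o
        ∂(Measure.pi fun _ => observedLaw P) := by
  have hmeas := L.measurableSet_notMem_sampleInterval_const (k := k) hα y
  exact ((measurePreserving_observedSample ν P).measure_preimage hmeas.nullMeasurableSet).trans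
    (Measure.prod_apply_symm hmeas)

end MetaLearner

section Derandomization

variable {C B : Type*} [MeasurableSpace C] [MeasurableSpace B]

/-- The density, with respect to a law of a pair (cell, label) with conditional label law `κ`, of
the law with the same cells in which the label of cell `i` is `t i`. -/
noncomputable def labelDensity (κ : Kernel C B) (t : C → B) (z : C × B) : ℝ≥0∞ :=
  ({t z.1} : Set B).indicator (fun _ => (κ z.1 {t z.1})⁻¹) z.2

lemma labelDensity_eq_indicator_label (κ : Kernel C B) (t : C → B) (i : C) (b : B) :
    labelDensity κ t (i, b) = ({b} : Set B).indicator (fun _ => (κ i {b})⁻¹) (t i) := by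
  by_cases h : b = t i
  · subst h
    rfl
  · simp [labelDensity, h, Ne.symm h]

variable [MeasurableSingletonClass B]

lemma ae_compProd_kernel_singleton_ne_zero [Countable C] [MeasurableSingletonClass C] [Countable B]
    (π : Measure C) (κ : Kernel C B) : ∀ᵐ z ∂(π ⊗ₘ κ), κ z.1 {z.2} ≠ 0 :=
  Measure.ae_compProd_of_ae_ae (Set.to_countable _).measurableSet <|
    .of_forall fun _ => ae_iff_of_countable.2 fun _ hb => hb

lemma lintegral_indicator_singleton_inv (π : Measure B) [IsFiniteMeasure π] {a : B}
    (ha : π {a} ≠ 0) : ∫⁻ b, ({a} : Set B).indicator (fun _ => (π {a})⁻¹) b ∂π = 1 := by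
  rw [lintegral_indicator_const (measurableSet_singleton a),
    ENNReal.inv_mul_cancel ha (measure_ne_top π _)]

lemma lintegral_labelDensity_le_one (κ : Kernel C B) [IsFiniteKernel κ] (t : C → B) (i : C) :
    ∫⁻ b, labelDensity κ t (i, b) ∂κ i ≤ 1 := by
  simp_rw [labelDensity]
  rw [lintegral_indicator_const (measurableSet_singleton _)]
  exact ENNReal.inv_mul_le_one _

lemma lintegral_prod_labelDensity [Fintype C] {ι : Type*} [Fintype ι] (κ : Kernel C B)
    [IsMarkovKernel κ]
    {x : ι → C} (hx : Function.Injective x) {b : ι → B} (hb : ∀ i, κ (x i) {b i} ≠ 0) :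
    ∫⁻ t, ∏ i, labelDensity κ t (x i, b i) ∂(Measure.pi fun c => κ c) = 1 := by
  have hmeas : ∀ i, Measurable (({b i} : Set B).indicator fun _ => (κ (x i) {b i})⁻¹) := fun i =>
    measurable_const.indicator (measurableSet_singleton _)
  have hindep := ((iIndepFun_pi (μ := fun c => κ c) (X := fun _ b => b) fun _ =>
    aemeasurable_id).precomp hx).comp _ hmeas
  simp_rw [labelDensity_eq_indicator_label]
  refine (lintegral_prod_eq_prod_lintegral_of_indepFun Finset.univ _ hindep fun i =>
    (hmeas i).comp (measurable_pi_apply _)).trans (Finset.prod_eq_one fun i _ => ?_)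
  exact ((measurePreserving_eval (fun c => κ c) (x i)).lintegral_comp (hmeas i)).trans
    (lintegral_indicator_singleton_inv _ (hb i))

lemma measurable_labelDensity [Finite C] [MeasurableSingletonClass C] [Finite B]
    (κ : Kernel C B) (t : C → B) :
    Measurable (labelDensity κ t) :=
  measurable_of_finite _

variable [Finite B] [Nonempty B] {Ω : Type*} [MeasurableSpace Ω]

/-- The conditional law of the label given the cell, for `f` mapping a point to the pair
(cell, label). -/
noncomputable def labelKernel (μ : Measure Ω) [IsFiniteMeasure μ] (f : Ω → C × B) : Kernel C B :=
  (μ.map f).condKernel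

instance (μ : Measure Ω) [IsFiniteMeasure μ] (f : Ω → C × B) :
    IsMarkovKernel (labelKernel μ f) := by
  unfold labelKernel
  infer_instance

/-- The law `μ` conditioned, within each cell `i`, on the label being `t i`; the cells keep their
masses. It is a probability measure as soon as no `t i` is a null label of its cell. -/
noncomputable def derandomizedLaw (μ : Measure Ω) [IsFiniteMeasure μ] (f : Ω → C × B) (t : C → B) :
    Measure Ω :=
  μ.withDensity (labelDensity (labelKernel μ f) t ∘ f)

variable {μ : Measure Ω} {f : Ω → C × B}

section FiniteMeasure

variable [IsFiniteMeasure μ]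

lemma derandomizedLaw_absolutelyContinuous (t : C → B) : derandomizedLaw μ f t ≪ μ :=
  withDensity_absolutelyContinuous _ _

variable [Finite C] [MeasurableSingletonClass C]

lemma measurable_labelDensity_comp (hf : Measurable f) (t : C → B) :
    Measurable (labelDensity (labelKernel μ f) t ∘ f) :=
  (measurable_labelDensity _ t).comp hf

lemma ae_labelKernel_singleton_ne_zero (hf : Measurable f) :
    ∀ᵐ ω ∂μ, labelKernel μ f (f ω).1 {(f ω).2} ≠ 0 := by
  have h := ae_compProd_kernel_singleton_ne_zero (μ.map f).fst (labelKernel μ f)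
  rw [labelKernel, Measure.disintegrate] at h
  exact ae_of_ae_map hf.aemeasurable h

lemma ae_derandomizedLaw_label_eq (hf : Measurable f) (t : C → B) :
    ∀ᵐ ω ∂(derandomizedLaw μ f t), (f ω).2 = t (f ω).1 :=
  (ae_withDensity_iff (measurable_labelDensity_comp hf t)).2 <| .of_forall fun _ hω =>
    by_contra fun h => hω (by simp [labelDensity, h])

lemma derandomizedLaw_univ (hf : Measurable f) (t : C → B) :
    derandomizedLaw μ f t Set.univ =
      ∫⁻ i, ∫⁻ b, labelDensity (labelKernel μ f) t (i, b) ∂labelKernel μ f i ∂(μ.map f).fst := by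
  rw [derandomizedLaw, withDensity_apply _ .univ, Measure.restrict_univ,
    ← Measure.lintegral_compProd (measurable_labelDensity _ t)]
  conv_rhs => rw [labelKernel, Measure.disintegrate]
  exact (lintegral_map (measurable_labelDensity _ t) hf).symm

lemma isFiniteMeasure_derandomizedLaw (hf : Measurable f) (t : C → B) :
    IsFiniteMeasure (derandomizedLaw μ f t) := by
  refine ⟨(derandomizedLaw_univ hf t).trans_lt ?_⟩
  calc _ ≤ ∫⁻ _, 1 ∂(μ.map f).fst := lintegral_mono fun i => lintegral_labelDensity_le_one _ t i
    _ < ∞ := by simp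

end FiniteMeasure

variable [IsProbabilityMeasure μ]

lemma isProbabilityMeasure_derandomizedLaw [Finite C] [MeasurableSingletonClass C]
    (hf : Measurable f) {t : C → B} (ht : ∀ i, labelKernel μ f i {t i} ≠ 0) :
    IsProbabilityMeasure (derandomizedLaw μ f t) := by
  have := Measure.isProbabilityMeasure_map (μ := μ) hf.aemeasurable
  constructor
  simp_rw [derandomizedLaw_univ hf t, labelDensity]
  simp [lintegral_indicator_singleton_inv _ (ht _)]

lemma ae_isProbabilityMeasure_derandomizedLaw [Fintype C] [MeasurableSingletonClass C]
    (hf : Measurable f) : ∀ᵐ t ∂(Measure.pi fun i => labelKernel μ f i),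
      IsProbabilityMeasure (derandomizedLaw μ f t) := by
  have hlabel : ∀ᵐ t ∂(Measure.pi fun i => labelKernel μ f i), ∀ i, labelKernel μ f i {t i} ≠ 0 :=
    ae_all_iff.2 fun i => (measurePreserving_eval (fun i => labelKernel μ f i)
      i).quasiMeasurePreserving.ae (ae_iff_of_countable.2 fun _ hb => hb)
  exact hlabel.mono fun t ht => isProbabilityMeasure_derandomizedLaw hf ht

variable {ι : Type*} [Fintype ι] {F : (ι → Ω) → ℝ≥0∞}

lemma lintegral_pi_derandomizedLaw [Finite C] [MeasurableSingletonClass C] (hf : Measurable f)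
    (t : C → B) (hF : Measurable F) :
    ∫⁻ w, F w ∂(Measure.pi fun _ : ι => derandomizedLaw μ f t) =
      ∫⁻ w, (∏ i, labelDensity (labelKernel μ f) t (f (w i))) * F w
        ∂(Measure.pi fun _ : ι => μ) := by
  have hr := measurable_labelDensity_comp (μ := μ) hf t
  have : IsFiniteMeasure (μ.withDensity (labelDensity (labelKernel μ f) t ∘ f)) :=
    isFiniteMeasure_derandomizedLaw hf t
  simp_rw [derandomizedLaw]
  rw [pi_withDensity _ fun _ => hr, lintegral_withDensity_eq_lintegral_mul _ _ hF]
  · rfl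
  · exact Finset.measurable_prod _ fun i _ => hr.comp (measurable_pi_apply i)

/-- Labels of points in distinct cells are independent given the cells, so drawing one label `t i`
per cell in advance reproduces the sample as long as no cell is hit twice. -/
lemma lintegral_pi_le_add_lintegral_derandomizedLaw [Fintype C] [MeasurableSingletonClass C]
    (hf : Measurable f) (hF : Measurable F) (hF1 : ∀ w, F w ≤ 1) :
    ∫⁻ w, F w ∂(Measure.pi fun _ : ι => μ) ≤
      (Measure.pi fun _ : ι => μ) {w | ¬ Function.Injective fun i => (f (w i)).1} +
      ∫⁻ t, ∫⁻ w, F w ∂(Measure.pi fun _ : ι => derandomizedLaw μ f t)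
        ∂(Measure.pi fun i => labelKernel μ f i) := by
  set S : Set (ι → Ω) := {w | ¬ Function.Injective fun i => (f (w i)).1}
  have hS : MeasurableSet S :=
    (by fun_prop : Measurable fun (w : ι → Ω) i => (f (w i)).1)
      (Set.toFinite {g : ι → C | ¬ Function.Injective g}).measurableSet
  have hD : Measurable fun z : (ι → Ω) × (C → B) =>
      ∏ i, labelDensity (labelKernel μ f) z.2 (f (z.1 i)) :=
    (measurable_of_finite fun q : (ι → C × B) × (C → B) =>
      ∏ i, labelDensity (labelKernel μ f) q.2 (q.1 i)).comp (by fun_prop : Measurable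
        fun z : (ι → Ω) × (C → B) => ((fun i => f (z.1 i), z.2) : (ι → C × B) × (C → B)))
  have hlabel : ∀ᵐ w ∂(Measure.pi fun _ : ι => μ),
      ∀ i, labelKernel μ f (f (w i)).1 {(f (w i)).2} ≠ 0 :=
    ae_all_iff.2 fun i => (measurePreserving_eval (fun _ => μ) i).quasiMeasurePreserving.ae
      (ae_labelKernel_singleton_ne_zero hf)
  calc ∫⁻ w, F w ∂(Measure.pi fun _ : ι => μ)
      ≤ ∫⁻ w, (S.indicator 1 w + ∫⁻ t, (∏ i, labelDensity (labelKernel μ f) t (f (w i))) * F w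
          ∂(Measure.pi fun i => labelKernel μ f i)) ∂(Measure.pi fun _ : ι => μ) := by
        refine lintegral_mono_ae (hlabel.mono fun w hw => ?_)
        by_cases hinj : Function.Injective fun i => (f (w i)).1
        · rw [lintegral_mul_const _ (measurable_of_finite _),
            lintegral_prod_labelDensity _ hinj hw, one_mul]
          exact le_add_self
        · rw [Set.indicator_of_mem (show w ∈ S from hinj)]
          exact (hF1 w).trans le_self_add
    _ = (Measure.pi fun _ : ι => μ) S + ∫⁻ t, ∫⁻ w,
          (∏ i, labelDensity (labelKernel μ f) t (f (w i))) * F w ∂(Measure.pi fun _ : ι => μ)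
          ∂(Measure.pi fun i => labelKernel μ f i) := by
        rw [lintegral_add_left (measurable_one.indicator hS), lintegral_indicator_one hS,
          lintegral_lintegral_swap (hD.mul (hF.comp measurable_fst)).aemeasurable]
    _ = _ := by simp_rw [lintegral_pi_derandomizedLaw hf _ hF]

lemma lintegral_pi_le_of_derandomizedLaw_le [Finite C] [MeasurableSingletonClass C]
    (hf : Measurable f) (hF : Measurable F) (hF1 : ∀ w, F w ≤ 1) {a : ℝ≥0∞}
    (ha : ∀ t, IsProbabilityMeasure (derandomizedLaw μ f t) →
      ∫⁻ w, F w ∂(Measure.pi fun _ : ι => derandomizedLaw μ f t) ≤ a) :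
    ∫⁻ w, F w ∂(Measure.pi fun _ : ι => μ) ≤
      (Measure.pi fun _ : ι => μ) {w | ¬ Function.Injective fun i => (f (w i)).1} + a := by
  have := Fintype.ofFinite C
  refine (lintegral_pi_le_add_lintegral_derandomizedLaw hf hF hF1).trans (add_le_add_right ?_ _)
  calc _ ≤ ∫⁻ _, a ∂(Measure.pi fun i => labelKernel μ f i) :=
        lintegral_mono_ae ((ae_isProbabilityMeasure_derandomizedLaw hf).mono ha)
    _ = a := by simp

end Derandomization

section Cells

variable {E : Type*} [MeasurableSpace E]

section CountablyGenerated

variable [MeasurableSpace.CountablyGenerated E] {N N' : ℕ} {x x' : E}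

/-- The cell of a point in the finite partition of the space generated by the first `N` sets of a
countable generating family. -/
noncomputable def cell (N : ℕ) (x : E) : Fin N → Bool :=
  fun i => MeasurableSpace.mapNatBool E x i

lemma measurable_cell (N : ℕ) : Measurable (cell N : E → Fin N → Bool) :=
  measurable_pi_lambda _ fun i =>
    (measurable_pi_apply (i : ℕ)).comp (MeasurableSpace.measurable_mapNatBool E)

lemma cell_eq_of_le (h : N ≤ N') (hx : cell N' x = cell N' x') : cell N x = cell N x' :=
  funext fun i => congrFun hx (Fin.castLE h i)

lemma exists_cell_ne [MeasurableSpace.SeparatesPoints E] (h : x ≠ x') :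
    ∃ N, cell N x ≠ cell N x' := by
  obtain ⟨n, hn⟩ := Function.ne_iff.1 ((MeasurableSpace.injective_mapNatBool E).ne h)
  exact ⟨n + 1, fun hx => hn (congrFun hx (Fin.last n))⟩

lemma measurableSet_not_injective_cell {ι : Type*} [Finite ι] (N : ℕ) :
    MeasurableSet {w : ι → E | ¬ Function.Injective fun i => cell N (w i)} :=
  (measurable_pi_lambda _ fun i => (measurable_cell N).comp (measurable_pi_apply i) :
    Measurable fun (w : ι → E) i => cell N (w i))
    (Set.toFinite {g : ι → Fin N → Bool | ¬ Function.Injective g}).measurableSet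

lemma exists_injective_cell [MeasurableSpace.SeparatesPoints E] {ι : Type*} [Finite ι]
    {w : ι → E} (hw : Function.Injective w) : ∃ N, Function.Injective fun i => cell N (w i) := by
  have := Fintype.ofFinite ι
  have hsep : ∀ z : ι × ι, ∃ N, z.1 ≠ z.2 → cell N (w z.1) ≠ cell N (w z.2) := fun z => by
    by_cases hz : z.1 = z.2
    · exact ⟨0, fun h => absurd hz h⟩
    · exact (exists_cell_ne (hw.ne hz)).imp fun _ h _ => h
  choose N hN using hsep
  refine ⟨Finset.univ.sup N, fun i j hij => by_contra fun hne => hN (i, j) hne ?_⟩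
  exact cell_eq_of_le (Finset.le_sup (f := N) (Finset.mem_univ (i, j))) hij

end CountablyGenerated

variable {ι : Type*} [Fintype ι] [MeasurableEq E] (π : Measure E) [IsProbabilityMeasure π]
  [NullSingletonClass π]

lemma ae_pi_ne {i j : ι} (hij : i ≠ j) : ∀ᵐ w ∂(Measure.pi fun _ : ι => π), w i ≠ w j := by
  have hmap := (((iIndepFun_pi (μ := fun _ : ι => π) (X := fun _ x => x)
    fun _ => aemeasurable_id).indepFun hij).map_prod_eq_prod_map_map
    (measurable_pi_apply i).aemeasurable (measurable_pi_apply j).aemeasurable)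
  rw [(measurePreserving_eval (fun _ : ι => π) i).map_eq,
    (measurePreserving_eval (fun _ : ι => π) j).map_eq] at hmap
  have hne : ∀ᵐ z ∂(π.prod π), z.1 ≠ z.2 :=
    Measure.ae_prod_iff_ae_ae measurableSet_diagonal.compl |>.2 <|
      .of_forall fun x => (Measure.ae_ne π x).mono fun _ h => h.symm
  rw [← hmap] at hne
  exact ae_of_ae_map (p := fun z : E × E => z.1 ≠ z.2) (by fun_prop) hne

lemma ae_pi_injective : ∀ᵐ w ∂(Measure.pi fun _ : ι => π), Function.Injective w := by
  have hne : ∀ᵐ w ∂(Measure.pi fun _ : ι => π), ∀ i j, i ≠ j → w i ≠ w j :=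
    ae_all_iff.2 fun i => ae_all_iff.2 fun j => Filter.eventually_imp_distrib_left.2 (ae_pi_ne π)
  exact hne.mono fun w hw i j => not_imp_not.1 (hw i j)

lemma tendsto_pi_not_injective_cell [MeasurableSpace.CountablyGenerated E] :
    Tendsto (fun N => (Measure.pi fun _ : ι => π)
      {w | ¬ Function.Injective fun i => cell N (w i)}) atTop (𝓝 0) := by
  set S : ℕ → Set (ι → E) := fun N => {w | ¬ Function.Injective fun i => cell N (w i)}
  have hanti : Antitone S := fun N N' h w hw hinj =>
    hw fun i j hij => hinj (cell_eq_of_le h hij)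
  have hnull : (Measure.pi fun _ : ι => π) (⋂ N, S N) = 0 := by
    refine measure_eq_zero_iff_ae_notMem.2 ((ae_pi_injective π).mono fun w hw hS => ?_)
    obtain ⟨N, hN⟩ := exists_injective_cell hw
    exact Set.mem_iInter.1 hS N hN
  rw [← hnull]
  exact tendsto_measure_iInter_atTop
    (fun N => (measurableSet_not_injective_cell N).nullMeasurableSet) hanti ⟨0, measure_ne_top _ _⟩

end Cells

section Assignment

variable (lam : Measure (Cov p × ℝ × ℝ)) [IsProbabilityMeasure lam]
  (η : Kernel (Cov p) Bool) [IsMarkovKernel η]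

/-- The law of a unit whose covariates and potential outcomes have law `lam`, and whose treatment
is then drawn from `η` given the covariates alone. -/
noncomputable def assignLaw : ProbabilityMeasure (FullData p) :=
  ⟨(lam ⊗ₘ η.prodMkRight (ℝ × ℝ)).map MeasurableEquiv.prodAssoc,
    Measure.isProbabilityMeasure_map MeasurableEquiv.prodAssoc.measurable.aemeasurable⟩

lemma coe_assignLaw : (assignLaw lam η : Measure (FullData p)) =
    (lam ⊗ₘ η.prodMkRight (ℝ × ℝ)).map MeasurableEquiv.prodAssoc :=
  rfl

lemma lintegral_assignLaw {f : FullData p → ℝ≥0∞} (hf : Measurable f) :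
    ∫⁻ ω, f ω ∂(assignLaw lam η : Measure (FullData p)) =
      ∫⁻ z, ∫⁻ t, f (z.1, z.2, t) ∂η z.1 ∂lam := by
  rw [coe_assignLaw, lintegral_map hf MeasurableEquiv.prodAssoc.measurable]
  exact Measure.lintegral_compProd (hf.comp MeasurableEquiv.prodAssoc.measurable)

lemma measurable_covariate_outcomes :
    Measurable fun ω : FullData p => (covariate ω, outcomes ω) :=
  measurable_covariate.prodMk measurable_outcomes

lemma measurePreserving_covariate_outcomes_assignLaw :
    MeasurePreserving (fun ω => (covariate ω, outcomes ω))
      (assignLaw lam η : Measure (FullData p)) lam := by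
  refine ⟨measurable_covariate_outcomes, ?_⟩
  rw [coe_assignLaw, Measure.map_map measurable_covariate_outcomes
    MeasurableEquiv.prodAssoc.measurable]
  exact Measure.fst_compProd _ _

lemma condDistrib_treatment_covariate_outcomes_assignLaw :
    condDistrib treatment (fun ω => (covariate ω, outcomes ω)) (assignLaw lam η : Measure _)
      =ᵐ[(assignLaw lam η : Measure (FullData p)).map fun ω => (covariate ω, outcomes ω)]
      η.prodMkRight (ℝ × ℝ) := by
  refine condDistrib_ae_eq_of_measure_eq_compProd _ measurable_treatment.aemeasurable ?_
  rw [(measurePreserving_covariate_outcomes_assignLaw lam η).map_eq, coe_assignLaw,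
    Measure.map_map (measurable_covariate_outcomes.prodMk measurable_treatment)
      MeasurableEquiv.prodAssoc.measurable]
  exact Measure.map_id

lemma condDistrib_treatment_covariate_assignLaw :
    condDistrib treatment covariate (assignLaw lam η : Measure _)
      =ᵐ[(assignLaw lam η : Measure (FullData p)).map covariate] η := by
  refine condDistrib_ae_eq_of_measure_eq_compProd _ measurable_treatment.aemeasurable ?_
  refine Measure.ext_of_lintegral _ fun f hf => ?_
  have hinner : Measurable fun x => ∫⁻ t, f (x, t) ∂η x := hf.lintegral_kernel_prod_right'
  calc _ = ∫⁻ z, ∫⁻ t, f (z.1, t) ∂η z.1 ∂lam := by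
        have hXT := measurable_covariate.prodMk (measurable_treatment (p := p))
        rw [lintegral_map hf hXT]
        exact lintegral_assignLaw lam η (hf.comp hXT)
    _ = ∫⁻ ω, ∫⁻ t, f (covariate ω, t) ∂η (covariate ω)
          ∂(assignLaw lam η : Measure (FullData p)) :=
        ((measurePreserving_covariate_outcomes_assignLaw lam η).lintegral_comp
          (hinner.comp measurable_fst)).symm
    _ = _ := by rw [Measure.lintegral_compProd hf, lintegral_map hinner measurable_covariate]

lemma condIndepFun_assignLaw :
    CondIndepFun (covariateSigma p) (covariateSigma_le p) outcomes treatment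
      (assignLaw lam η : Measure (FullData p)) := by
  refine (condIndepFun_iff_condDistrib_prod_ae_eq_prodMkRight measurable_treatment
    measurable_outcomes measurable_covariate).2
    ((condDistrib_treatment_covariate_outcomes_assignLaw lam η).trans ?_)
  have h := condDistrib_treatment_covariate_assignLaw lam η
  have hfst : (assignLaw lam η : Measure (FullData p)).map covariate =
      ((assignLaw lam η : Measure (FullData p)).map fun ω => (covariate ω, outcomes ω)).map
        Prod.fst := (Measure.map_map measurable_fst measurable_covariate_outcomes).symm
  rw [hfst] at h
  exact (ae_of_ae_map measurable_fst.aemeasurable h).mono fun z hz => hz.symm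

lemma propensity_assignLaw_ae_eq : ∀ᵐ ω ∂(assignLaw lam η : Measure (FullData p)),
    propensity (assignLaw lam η) ω = (η (covariate ω)).real {true} := by
  filter_upwards [condDistrib_ae_eq_condExp (μ := (assignLaw lam η : Measure (FullData p)))
      measurable_covariate measurable_treatment (measurableSet_singleton true),
    ae_of_ae_map measurable_covariate.aemeasurable
      (condDistrib_treatment_covariate_assignLaw lam η)] with ω hprop hη
  rw [propensity, ← hprop, hη]

lemma assignLaw_mem_baseClass (hX : ∃ j : Fin p, lam.map (fun z => z.1 j) ≪ volume)
    (h₁ : ∀ y : ℝ, lam {z | z.2.1 = y} = 0) (h₀ : ∀ y : ℝ, lam {z | z.2.2 = y} = 0) :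
    assignLaw lam η ∈ baseClass p := by
  have hlam := measurePreserving_covariate_outcomes_assignLaw lam η
  refine ⟨hX.imp fun j hj => ?_, fun y => ?_, fun y => ?_⟩
  · rwa [← hlam.map_eq, Measure.map_map (by fun_prop) hlam.measurable] at hj
  · exact (hlam.measure_preimage (measurableSet_eq_fun (by fun_prop)
      measurable_const).nullMeasurableSet).trans (h₁ y)
  · exact (hlam.measure_preimage (measurableSet_eq_fun (by fun_prop)
      measurable_const).nullMeasurableSet).trans (h₀ y)

variable {lam η}

lemma assignLaw_mem_siStrClass (hbase : assignLaw lam η ∈ baseClass p) {c : ℝ} (hc : 0 < c)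
    (hη : ∀ x, (η x).real {true} ∈ Set.Icc c (1 - c)) : assignLaw lam η ∈ siStrClass p :=
  ⟨⟨hbase, condIndepFun_assignLaw lam η⟩, c, hc,
    (propensity_assignLaw_ae_eq lam η).mono fun ω hω => hω ▸ hη (covariate ω)⟩

end Assignment

section Noise

open unitInterval

/-- The law of the label `b` flipped with probability `ε`. -/
noncomputable def noisyLabel (ε : I) : Kernel Bool Bool where
  toFun b := bernoulliMeasure (!b) b ε
  measurable' := measurable_of_finite _

lemma noisyLabel_apply (ε : I) (b : Bool) : noisyLabel ε b = bernoulliMeasure (!b) b ε := rfl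

instance (ε : I) : IsMarkovKernel (noisyLabel ε) :=
  ⟨fun b => inferInstanceAs (IsProbabilityMeasure (bernoulliMeasure (!b) b ε))⟩

lemma noisyLabel_real_true_mem_Icc {ε : I} (hε : (ε : ℝ) ≤ 1 / 2) (b : Bool) :
    (noisyLabel ε b).real {true} ∈ Set.Icc (ε : ℝ) (1 - ε) := by
  cases b
  · rw [noisyLabel_apply, bernoulliMeasure_real_apply_of_mem_of_notMem _
      (measurableSet_singleton _) (by simp) (by simp)]
    exact ⟨le_rfl, by linarith⟩
  · rw [noisyLabel_apply, bernoulliMeasure_real_apply_of_notMem_of_mem _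
      (measurableSet_singleton _) (by simp) (by simp)]
    exact ⟨by linarith, le_rfl⟩

lemma mul_le_lintegral_noisyLabel (ε : I) (b : Bool) (f : Bool → ℝ≥0∞) :
    toNNReal (σ ε) * f b ≤ ∫⁻ t, f t ∂noisyLabel ε b := by
  rw [noisyLabel_apply, bernoulliMeasure_def, lintegral_add_measure, lintegral_smul_measure,
    lintegral_smul_measure, lintegral_dirac, lintegral_dirac]
  exact le_add_self

end Noise

section Twin

/-- The covariates of a unit observed as `o`, together with the potential outcomes that agree with
`o` and have treatment effect `y`. -/
def completeOutcomes (y : ℝ) (o : ObsData p) : Cov p × ℝ × ℝ :=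
  (o.1, if o.2.1 then (o.2.2, o.2.2 - y) else (o.2.2 + y, o.2.2))

lemma measurable_completeOutcomes (y : ℝ) :
    Measurable (completeOutcomes y : ObsData p → Cov p × ℝ × ℝ) :=
  measurable_fst.prodMk <|
    Measurable.ite ((measurable_fst.comp measurable_snd) (measurableSet_singleton true))
      (by fun_prop) (by fun_prop)

lemma completeOutcomes_effect (y : ℝ) (o : ObsData p) :
    (completeOutcomes y o).2.1 - (completeOutcomes y o).2.2 = y := by
  unfold completeOutcomes
  split_ifs <;> simp

lemma observe_completeOutcomes (y : ℝ) (o : ObsData p) :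
    observe ((completeOutcomes y o).1, (completeOutcomes y o).2, o.2.1) = o := by
  obtain ⟨x, _ | _, v⟩ := o <;> rfl

instance (y : ℝ) (ρ : Measure (ObsData p)) [IsProbabilityMeasure ρ] :
    IsProbabilityMeasure (ρ.map (completeOutcomes y)) :=
  Measure.isProbabilityMeasure_map (measurable_completeOutcomes y).aemeasurable

/-- The law of a unit with treatment effect `y`: its covariates and the outcome of one arm are
drawn from the observed law `ρ`, and its treatment is `g` of the covariates, flipped with
probability `ε` to secure overlap. -/
noncomputable def twinLaw (ρ : Measure (ObsData p)) [IsProbabilityMeasure ρ] (y : ℝ)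
    (ε : unitInterval) {g : Cov p → Bool} (hg : Measurable g) : ProbabilityMeasure (FullData p) :=
  assignLaw (ρ.map (completeOutcomes y)) ((noisyLabel ε).comap g hg)

variable {P : ProbabilityMeasure (FullData p)} {ρ : Measure (ObsData p)}

lemma observedLaw_map_covariate (P : ProbabilityMeasure (FullData p)) (j : Fin p) :
    (observedLaw P).map (fun o => o.1 j) =
      (P : Measure (FullData p)).map fun ω => covariate ω j :=
  Measure.map_map (by fun_prop) measurable_observe

lemma observedLaw_outcome_eq_null (hP : P ∈ baseClass p) (a b : ℝ) :
    observedLaw P {o | o.2.2 = if o.2.1 then a else b} = 0 := by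
  have hm : MeasurableSet {o : ObsData p | o.2.2 = if o.2.1 then a else b} :=
    measurableSet_eq_fun (by fun_prop) <|
      (measurable_of_finite fun t : Bool => if t then a else b).comp (by fun_prop)
  rw [← (measurePreserving_observe P).measure_preimage hm.nullMeasurableSet]
  refine measure_mono_null (fun ω hω => ?_) (measure_union_null (hP.2.1 a) (hP.2.2 b))
  cases hT : treatment ω
  · exact .inr (by simpa [observe, hT] using hω)
  · exact .inl (by simpa [observe, hT] using hω)

variable [IsProbabilityMeasure ρ] {g : Cov p → Bool}

lemma twinLaw_mem_baseClass (hP : P ∈ baseClass p) (hρ : ρ ≪ observedLaw P) (y : ℝ)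
    (ε : unitInterval) (hg : Measurable g) : twinLaw ρ y ε hg ∈ baseClass p := by
  have hm := measurable_completeOutcomes (p := p) y
  refine assignLaw_mem_baseClass _ _ ?_ (fun a => ?_) (fun a => ?_)
  · refine hP.1.imp fun j hj => ?_
    rw [Measure.map_map (by fun_prop) hm]
    rw [← observedLaw_map_covariate] at hj
    exact (hρ.map (f := fun o : ObsData p => o.1 j) (by fun_prop)).trans hj
  · rw [Measure.map_apply hm (measurableSet_eq_fun (by fun_prop) measurable_const)]
    refine measure_mono_null (fun o ho => ?_) (hρ (observedLaw_outcome_eq_null hP a (a - y)))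
    obtain ⟨x, _ | _, v⟩ := o
    · exact eq_sub_of_add_eq ho
    · exact ho
  · rw [Measure.map_apply hm (measurableSet_eq_fun (by fun_prop) measurable_const)]
    refine measure_mono_null (fun o ho => ?_) (hρ (observedLaw_outcome_eq_null hP (a + y) a))
    obtain ⟨x, _ | _, v⟩ := o
    · exact ho
    · exact eq_add_of_sub_eq ho

lemma twinLaw_mem_siStrClass (hP : P ∈ baseClass p) (hρ : ρ ≪ observedLaw P) (y : ℝ)
    {ε : unitInterval} (hε₀ : 0 < (ε : ℝ)) (hε : (ε : ℝ) ≤ 1 / 2) (hg : Measurable g) :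
    twinLaw ρ y ε hg ∈ siStrClass p :=
  assignLaw_mem_siStrClass (twinLaw_mem_baseClass hP hρ y ε hg) hε₀ fun x =>
    noisyLabel_real_true_mem_Icc hε (g x)

lemma ae_twinLaw_effect_eq (y : ℝ) (ε : unitInterval) (hg : Measurable g) :
    ∀ᵐ ω ∂(twinLaw ρ y ε hg : Measure (FullData p)), effect ω = y := by
  refine (measurePreserving_covariate_outcomes_assignLaw _ _).quasiMeasurePreserving.ae
    (p := fun z : Cov p × ℝ × ℝ => z.2.1 - z.2.2 = y) ?_
  exact (ae_map_iff (measurable_completeOutcomes y).aemeasurable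
    (measurableSet_eq_fun (by fun_prop) measurable_const)).2
    (.of_forall (completeOutcomes_effect y))

lemma lintegral_twinLaw (y : ℝ) (ε : unitInterval) (hg : Measurable g) {f : FullData p → ℝ≥0∞}
    (hf : Measurable f) : ∫⁻ ω, f ω ∂(twinLaw ρ y ε hg : Measure (FullData p)) =
      ∫⁻ o, ∫⁻ t, f ((completeOutcomes y o).1, (completeOutcomes y o).2, t)
        ∂noisyLabel ε (g o.1) ∂ρ := by
  rw [twinLaw, lintegral_assignLaw _ _ hf]
  refine lintegral_map ?_ (measurable_completeOutcomes y)
  exact (hf.comp MeasurableEquiv.prodAssoc.measurable).lintegral_kernel_prod_right'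
    (κ := ((noisyLabel ε).comap g hg).prodMkRight (ℝ × ℝ))

lemma smul_le_observedLaw_twinLaw (y : ℝ) (ε : unitInterval) (hg : Measurable g)
    (hgρ : ∀ᵐ o ∂ρ, o.2.1 = g o.1) :
    unitInterval.toNNReal (unitInterval.symm ε) • ρ ≤ observedLaw (twinLaw ρ y ε hg) := by
  refine Measure.le_iff.2 fun s hs => ?_
  have hind : Measurable (s.indicator (1 : ObsData p → ℝ≥0∞)) := measurable_one.indicator hs
  rw [← lintegral_indicator_one hs, ← lintegral_indicator_one hs, lintegral_smul_measure,
    ENNReal.smul_def, smul_eq_mul, ← lintegral_const_mul _ hind, observedLaw,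
    lintegral_map hind measurable_observe,
    lintegral_twinLaw (f := fun ω => s.indicator 1 (observe ω)) y ε hg
      (hind.comp measurable_observe)]
  refine lintegral_mono_ae (hgρ.mono fun o ho => ?_)
  have h := mul_le_lintegral_noisyLabel ε (g o.1) fun t =>
    s.indicator 1 (observe ((completeOutcomes y o).1, (completeOutcomes y o).2, t))
  simpa only [← ho, observe_completeOutcomes] using h

end Twin

section Coverage

variable {ν : Measure U} [IsProbabilityMeasure ν] {L : MetaLearner p m U}
  {P : ProbabilityMeasure (FullData p)} {y : ℝ}

lemma symm_pow_mul_lintegral_missProb_le (hα : α ∈ Set.Ico (0 : ℝ) 1)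
    (hdom : ∀ Q ∈ siStrClass p, (∀ᵐ ω ∂(Q : Measure (FullData p)), effect ω = y) →
      L.PseudoDominatesOracle ν Q)
    (hP : P ∈ baseClass p) {ρ : Measure (ObsData p)} [IsProbabilityMeasure ρ]
    (hρ : ρ ≪ observedLaw P) {g : Cov p → Bool} (hg : Measurable g)
    (hgρ : ∀ᵐ o ∂ρ, o.2.1 = g o.1) {ε : unitInterval} (hε₀ : 0 < (ε : ℝ))
    (hε : (ε : ℝ) ≤ 1 / 2) :
    ((unitInterval.toNNReal (unitInterval.symm ε) ^ Fintype.card (SampleIndex m k) : ℝ≥0) : ℝ≥0∞) *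
      ∫⁻ o, L.missProb ν α y o ∂(Measure.pi fun _ : SampleIndex m k => ρ) ≤ ENNReal.ofReal α := by
  have heffect := ae_twinLaw_effect_eq (ρ := ρ) y ε hg
  rw [← smul_eq_mul, ← ENNReal.smul_def, ← lintegral_smul_measure]
  calc _ ≤ ∫⁻ o, L.missProb ν α y o
        ∂(Measure.pi fun _ : SampleIndex m k => observedLaw (twinLaw ρ y ε hg)) :=
        lintegral_mono' (pow_smul_pi_le_pi (smul_le_observedLaw_twinLaw y ε hg hgρ)) le_rfl
    _ = experimentLaw m k ν (twinLaw ρ y ε hg) {e | y ∉ L.intervalAtNew α e} :=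
        (L.experimentLaw_notMem_eq_lintegral_missProb hα.2 y).symm
    _ ≤ ENNReal.ofReal α :=
        (hdom _ (twinLaw_mem_siStrClass hP hρ y hε₀ hε hg)
          heffect).experimentLaw_notMem_le_of_effect_eq hα.1 hα.2 heffect

lemma lintegral_missProb_le_of_treatment_eq (hα : α ∈ Set.Ico (0 : ℝ) 1)
    (hdom : ∀ Q ∈ siStrClass p, (∀ᵐ ω ∂(Q : Measure (FullData p)), effect ω = y) →
      L.PseudoDominatesOracle ν Q)
    (hP : P ∈ baseClass p) {ρ : Measure (ObsData p)} [IsProbabilityMeasure ρ]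
    (hρ : ρ ≪ observedLaw P) {g : Cov p → Bool} (hg : Measurable g)
    (hgρ : ∀ᵐ o ∂ρ, o.2.1 = g o.1) :
    ∫⁻ o, L.missProb ν α y o ∂(Measure.pi fun _ : SampleIndex m k => ρ) ≤ ENNReal.ofReal α := by
  set K := ∫⁻ o, L.missProb ν α y o ∂(Measure.pi fun _ : SampleIndex m k => ρ)
  have hK : K ≠ ∞ := ((lintegral_mono fun o => prob_le_one).trans_lt (by simp)).ne
  have hcont : Continuous fun ε : unitInterval =>
      ((unitInterval.toNNReal (unitInterval.symm ε) ^ Fintype.card (SampleIndex m k) : ℝ≥0) :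
        ℝ≥0∞) * K :=
    (ENNReal.continuous_mul_const hK).comp <| ENNReal.continuous_coe.comp <|
      (unitInterval.toNNReal_continuous.comp unitInterval.continuous_symm).pow _
  have hlim := hcont.tendsto 0
  rw [unitInterval.symm_zero, unitInterval.toNNReal_one, one_pow, ENNReal.coe_one, one_mul] at hlim
  have hhalf : ∀ᶠ ε : unitInterval in 𝓝 0, (ε : ℝ) ≤ 1 / 2 :=
    (continuous_subtype_val.tendsto 0).eventually_le_const (by norm_num)
  have : (𝓝[>] (0 : unitInterval)).NeBot := nhdsGT_neBot_of_exists_gt ⟨1, zero_lt_one⟩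
  refine le_of_tendsto (x := 𝓝[>] 0) (hlim.mono_left nhdsWithin_le_nhds) ?_
  filter_upwards [self_mem_nhdsWithin, nhdsWithin_le_nhds hhalf] with ε hε₀ hε
  exact symm_pow_mul_lintegral_missProb_le hα hdom hP hρ hg hgρ hε₀ hε

lemma nullSingletonClass_observedLaw_map_fst (hP : P ∈ baseClass p) :
    NullSingletonClass ((observedLaw P).map Prod.fst) := by
  obtain ⟨j, hj⟩ := hP.1
  rw [← observedLaw_map_covariate] at hj
  refine ⟨fun x => ?_⟩
  have hnull := hj (measure_singleton (x j))
  rw [Measure.map_apply (by fun_prop) (measurableSet_singleton _)] at hnull ⊢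
  exact measure_mono_null (fun o ho => congrFun ho j) hnull

lemma tendsto_pi_observedLaw_not_injective_cell (hP : P ∈ baseClass p) (ι : Type*) [Fintype ι] :
    Tendsto (fun N => (Measure.pi fun _ : ι => observedLaw P)
      {w | ¬ Function.Injective fun i => cell N (w i).1}) atTop (𝓝 0) := by
  have := nullSingletonClass_observedLaw_map_fst hP
  have := Measure.isProbabilityMeasure_map (μ := observedLaw P)
    (measurable_fst (α := Cov p) (β := Bool × ℝ)).aemeasurable
  have hfst := measurePreserving_pi (fun _ : ι => observedLaw P) _ fun _ =>
    measurable_fst.measurePreserving (observedLaw P)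
  refine (tendsto_pi_not_injective_cell (ι := ι) ((observedLaw P).map Prod.fst)).congr fun N => ?_
  exact (hfst.measure_preimage (measurableSet_not_injective_cell N).nullMeasurableSet).symm

lemma experimentLaw_notMem_intervalAtNew_le (hα : α ∈ Set.Ico (0 : ℝ) 1)
    (hdom : ∀ Q ∈ siStrClass p, (∀ᵐ ω ∂(Q : Measure (FullData p)), effect ω = y) →
      L.PseudoDominatesOracle ν Q)
    (hP : P ∈ baseClass p) :
    experimentLaw m k ν P {e | y ∉ L.intervalAtNew α e} ≤ ENNReal.ofReal α := by
  rw [L.experimentLaw_notMem_eq_lintegral_missProb hα.2]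
  have hlim := (tendsto_pi_observedLaw_not_injective_cell hP (SampleIndex m k)).add_const
    (ENNReal.ofReal α)
  rw [zero_add] at hlim
  refine ge_of_tendsto' hlim fun N => ?_
  have hf : Measurable fun o : ObsData p => (cell N o.1, o.2.1) :=
    ((measurable_cell N).comp measurable_fst).prodMk (by fun_prop)
  refine lintegral_pi_le_of_derandomizedLaw_le hf (L.measurable_missProb hα.2 y)
    (fun _ => prob_le_one) fun t _ => ?_
  exact lintegral_missProb_le_of_treatment_eq hα hdom hP (derandomizedLaw_absolutelyContinuous t)
    ((measurable_of_finite t).comp (measurable_cell N)) (ae_derandomizedLaw_label_eq hf t)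

end Coverage

lemma lintegral_measure_eq_top_of_notMem_le {S E : Type*} [MeasurableSpace S] [MeasurableSpace E]
    (μ : Measure S) [IsProbabilityMeasure μ] (π : Measure E) [SFinite π] (hπ : π Set.univ = ∞)
    {C : S → Set E} (hC : MeasurableSet {z : S × E | z.2 ∉ C z.1}) {a : ℝ≥0∞} (ha : a < 1)
    (hmiss : ∀ y, μ {s | y ∉ C s} ≤ a) : ∫⁻ s, π (C s) ∂μ = ∞ := by
  have hmem : MeasurableSet {z : S × E | z.2 ∈ C z.1} := by
    simpa only [Set.compl_ofPred, not_not] using hC.compl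
  have htonelli : ∫⁻ s, π (C s) ∂μ = ∫⁻ y, μ {s | y ∈ C s} ∂π :=
    (Measure.prod_apply hmem).symm.trans (Measure.prod_apply_symm hmem)
  have hcover : ∀ y, 1 - a ≤ μ {s | y ∈ C s} := fun y => by
    have h : 1 - a ≤ μ {s | y ∉ C s}ᶜ := (tsub_le_tsub_left (hmiss y) 1).trans_eq
      (prob_compl_eq_one_sub (measurable_prodMk_right hC)).symm
    simpa only [Set.compl_ofPred, not_not] using h
  rw [htonelli, eq_top_iff]
  calc ∞ = ∫⁻ _, (1 - a) ∂π := by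
        rw [lintegral_const, hπ, ENNReal.mul_top (tsub_pos_of_lt ha).ne']
    _ ≤ _ := lintegral_mono hcover

lemma siStrClass_nonempty (hp : 0 < p) : (siStrClass p).Nonempty := by
  let γ : Measure ℝ := gaussianReal 0 1
  have hγ : NullSingletonClass γ := nullSingletonClass_gaussianReal one_ne_zero
  let half : unitInterval := ⟨1 / 2, by norm_num, by norm_num⟩
  refine ⟨_, assignLaw_mem_siStrClass (lam := (Measure.pi fun _ : Fin p => γ).prod (γ.prod γ))
    (η := Kernel.const _ (noisyLabel half true))
    (assignLaw_mem_baseClass _ _ ⟨⟨0, hp⟩, ?_⟩ (fun y => ?_) (fun y => ?_))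
    (by norm_num : (0 : ℝ) < 1 / 2) fun _ => noisyLabel_real_true_mem_Icc (ε := half) le_rfl true⟩
  · have h := (measurePreserving_eval (fun _ : Fin p => γ) ⟨0, hp⟩).comp
      (measurePreserving_fst (ν := γ.prod γ))
    exact h.map_eq.symm ▸ gaussianReal_absolutelyContinuous 0 one_ne_zero
  · have h := (measurePreserving_fst (μ := γ) (ν := γ)).comp
      (measurePreserving_snd (μ := Measure.pi fun _ : Fin p => γ))
    exact (h.measure_preimage (measurableSet_singleton y).nullMeasurableSet).trans
      (measure_singleton y)
  · have h := (measurePreserving_snd (μ := γ) (ν := γ)).comp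
      (measurePreserving_snd (μ := Measure.pi fun _ : Fin p => γ))
    exact (h.measure_preimage (measurableSet_singleton y).nullMeasurableSet).trans
      (measure_singleton y)

end ITE

theorem mainTheorem5_general (p m k : ℕ) {U : Type*} [MeasurableSpace U]
    (ν : Measure U) [IsProbabilityMeasure ν] (L : ITE.MetaLearner p m U)
    (α : ℝ) (hα : α ∈ Set.Ico (0 : ℝ) 1)
    (hdom : ∀ P ∈ ITE.siStrClass p,
      (∃ y : ℝ, ∀ᵐ ω ∂(P : Measure (ITE.FullData p)), ITE.effect ω = y) →
        L.PseudoDominatesOracle ν P) :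
    ∀ P ∈ ITE.baseClass p,
      (∀ y : ℝ, ITE.experimentLaw m k ν P {e | y ∉ L.intervalAtNew α e} ≤ ENNReal.ofReal α) ∧
      ∫⁻ e, volume (L.intervalAtNew α e) ∂(ITE.experimentLaw m k ν P) = ∞ := by
  intro P hP
  have hmiss : ∀ y : ℝ,
      ITE.experimentLaw m k ν P {e | y ∉ L.intervalAtNew α e} ≤ ENNReal.ofReal α := fun y =>
    ITE.experimentLaw_notMem_intervalAtNew_le hα (fun Q hQ hy => hdom Q hQ ⟨y, hy⟩) hP
  exact ⟨hmiss, ITE.lintegral_measure_eq_top_of_notMem_le _ _ Real.volume_univ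
    (L.measurableSet_notMem_intervalAtNew hα.2) (ENNReal.ofReal_lt_one.2 hα.2) hmiss⟩

theorem mainTheorem5 (p m k : ℕ) (hp : 0 < p) {U : Type*} [MeasurableSpace U]
    (ν : Measure U) [IsProbabilityMeasure ν] (L : ITE.MetaLearner p m U)
    (α : ℝ) (hα : α ∈ Set.Ioo (0 : ℝ) 1)
    (hdom : ∀ P ∈ ITE.siStrClass p, L.PseudoDominatesOracle ν P) :
    (∀ P ∈ ITE.siStrClass p, ∀ y : ℝ,
      ITE.experimentLaw m k ν P {e | y ∉ L.intervalAtNew α e} ≤ ENNReal.ofReal α) ∧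
    (⨆ P ∈ ITE.siStrClass p,
      ∫⁻ e, volume (L.intervalAtNew α e) ∂(ITE.experimentLaw m k ν P)) = ∞ := by
  have hgen := mainTheorem5_general p m k ν L α ⟨hα.1.le, hα.2⟩ fun P hP _ => hdom P hP
  obtain ⟨P, hP⟩ := ITE.siStrClass_nonempty hp
  exact ⟨fun Q hQ => (hgen Q hQ.1.1).1,
    top_unique ((hgen P hP.1.1).2.ge.trans (le_iSup₂_of_le P hP le_rfl))⟩
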